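/- Let $p \ge 1$, let $F_R$ be a probability distribution on $[0,\infty)$ which is not the point mass at $0$, and let $R \sim F_R$ with $E(R^8) < \infty$. Let $U$ be independent of $R$ and uniformly distributed on the unit sphere $\mathbb{S}^{p-1}$ of $\mathbb{R}^p$. For $\mu \in \mathbb{R}^p$ and a positive semidefinite matrix $\Sigma \in \mathbb{R}^{p \times p}$, let $P_{\mu,\Sigma}$ denote the distribution of $\mu + R\,\Sigma^{1/2} U$. Fix $\mu \in \mathbb{R}^p$ and $\lambda > 0$, let $X_1, X_2, \ldots$ be independent random vectors with distribution $P_{\mu, \lambda I_p}$, and for each $n$ let $$ O(P_n) = \frac{\frac{1}{n^3} \sum_{i=1}^n \sum_{j=1}^n \sum_{k=1}^n \|X_i - X_j\|^2 \|X_i - X_k\|^2}{\frac{1}{n^2} \sum_{i=1}^n \sum_{j=1}^n \|X_i - X_j\|^4} $$ be the sample object shape with respect to the Euclidean metric (with the convention that it is $0$ if the denominator vanishes). Write $q_r = E(R^r)$, $\beta_R = q_4/q_2^2$ and $$ u_R = \frac12 + \frac{p-1}{p(\beta_R+1)+2}, $$ $$ \sigma_R^2 = \frac{p^2 (p-1)^2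 q_2^2}{\{p(q_4+q_2^2) + 2 q_2^2\}^4} \left\{ 4 q_4^2 (q_4 - q_2^2) - 4 q_4 q_2 (q_6 - q_4 q_2) + q_2^2 (q_8 - q_4^2) \right\}. $$ Then $\sigma_R^2 \ge 0$ and, as $n \to \infty$, $$ \sqrt{n}\,\{u_R - O(P_n)\} \rightsquigarrow \mathcal{N}(0, \sigma_R^2), $$ where $\rightsquigarrow$ denotes convergence in distribution and $\mathcal{N}(0,0)$ is the point mass at $0$. -/

import Mathlib

open MeasureTheory ProbabilityTheory Filter
open scoped MatrixOrder

noncomputable section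

namespace ObjectShape

/-- The object shape `O(P_n)` of the empirical distribution of `n` points `x_1, …, x_n` of a
metric space: the mean of `d(x_i, x_j)² d(x_i, x_k)²` over all triples of indices divided by
the mean of `d(x_i, x_j)⁴` over all pairs of indices. -/
def sampleObjectShape {𝒳 : Type*} [PseudoMetricSpace 𝒳] {n : ℕ} (x : Fin n → 𝒳) : ℝ :=
  ((1 / (n : ℝ) ^ 3) * ∑ i, ∑ j, ∑ k, dist (x i) (x j) ^ 2 * dist (x i) (x k) ^ 2) /
    ((1 / (n : ℝ) ^ 2) * ∑ i, ∑ j, dist (x i) (x j) ^ 4)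

/-- The uniform probability distribution on the unit sphere of `ℝ^p` (for `p ≥ 1`): the
normalized surface measure. -/
def uniformSphere (p : ℕ) : Measure (Metric.sphere (0 : EuclideanSpace ℝ (Fin p)) 1) :=
  ((volume : Measure (EuclideanSpace ℝ (Fin p))).toSphere Set.univ)⁻¹ •
    (volume : Measure (EuclideanSpace ℝ (Fin p))).toSphere

/-- The elliptical distribution `P_{m, S}` on `ℝ^p` with radial distribution `F`: the law of
`m + R S^{1/2} U`, where `R ∼ F` and `U` are independent, `U` is uniform on the unit sphere and
`S^{1/2}` is the positive semidefinite square root of the positive semidefinite matrix `S`. -/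
def ellipticalLaw {p : ℕ} (F : Measure ℝ) (m : EuclideanSpace ℝ (Fin p))
    (S : Matrix (Fin p) (Fin p) ℝ) : Measure (EuclideanSpace ℝ (Fin p)) :=
  (F.prod (uniformSphere p)).map
    (fun z => m + z.1 • Matrix.toEuclideanLin (CFC.sqrt S) (z.2 : EuclideanSpace ℝ (Fin p)))

/-- The moment `q_k = E(R^k)` of `R ∼ F`. -/
def radialMoment (F : Measure ℝ) (k : ℕ) : ℝ := ∫ r, r ^ k ∂F

/-- `β_R = E(R⁴) / {E(R²)}²`. -/
def betaR (F : Measure ℝ) : ℝ := radialMoment F 4 / radialMoment F 2 ^ 2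

/-- `u_R = 1/2 + (p - 1) / (p (β_R + 1) + 2)`. -/
def uR (p : ℕ) (F : Measure ℝ) : ℝ :=
  1 / 2 + ((p : ℝ) - 1) / ((p : ℝ) * (betaR F + 1) + 2)

/-- The asymptotic variance `σ_R²`, as a function of `q_2, q_4, q_6, q_8`. -/
def sigmaSqR (p : ℕ) (F : Measure ℝ) : ℝ :=
  let q₂ := radialMoment F 2
  let q₄ := radialMoment F 4
  let q₆ := radialMoment F 6
  let q₈ := radialMoment F 8
  (p : ℝ) ^ 2 * ((p : ℝ) - 1) ^ 2 * q₂ ^ 2 / ((p : ℝ) * (q₄ + q₂ ^ 2) + 2 * q₂ ^ 2) ^ 4 *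
    (4 * q₄ ^ 2 * (q₄ - q₂ ^ 2) - 4 * q₄ * q₂ * (q₆ - q₄ * q₂) + q₂ ^ 2 * (q₈ - q₄ ^ 2))

end ObjectShape

end

/-! Distances are unchanged by translation, so `X i` may be replaced by `Y i = X i - m`, which has
the law of `√lam • (R • U)`. Expanding squared distances turns the numerator `N` and the denominator
`D` of the object shape into polynomials in sample averages (`sampleObjectShape_eq`). By the
symmetries of the sphere, the averages of `z a`, `‖z‖² z a` and the traceless part of `z zᵀ` have
mean zero, and they enter only through terms of second order. To first order, with `S` and `Q` the
averages of `‖z‖²` and `‖z‖⁴`, this leaves `N ≈ Q + 3 S²` and `D ≈ 2 Q + (2 + 4/p) S²`.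

The constant `u = uR p F` is the ratio of the two limits, so `u D - N` has no constant term
(`uR_mul_denLimit`). It is therefore the average of the mean-zero function `linearStat` plus a
remainder bounded by a convergent factor times a sum of squared centered averages
(`abs_expansion_remainder_le`). Each such square has expectation of order `1/n`, so `√n` times the
remainder vanishes in measure. The central limit theorem applies to the linear part, whose variance
after division by the limit `d` of `D` is `sigmaSqR` (`sigmaSqR_eq_variance`); this also proves `0 ≤
sigmaSqR`. Since `u - N/D = ((u D - N)/d) · (d/D)` and `D → d > 0` almost surely, Slutsky's theorem
concludes. -/

noncomputable section

namespace ObjectShape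

/-! ### Symmetries and second moments of the uniform law on the sphere -/

section Sphere

open scoped Pointwise

variable {p : ℕ}

theorem isProbabilityMeasure_uniformSphere (hp : 1 ≤ p) :
    IsProbabilityMeasure (uniformSphere p) := by
  have : Nonempty (Fin p) := ⟨⟨0, hp⟩⟩
  constructor
  rw [uniformSphere, Measure.smul_apply, smul_eq_mul]
  refine ENNReal.inv_mul_cancel ?_ (measure_ne_top _ _)
  rw [Ne, Measure.measure_univ_eq_zero]
  exact Measure.toSphere_ne_zero _

/-- The action of a linear isometry on the unit sphere. -/
def sphereMap (L : EuclideanSpace ℝ (Fin p) ≃ₗᵢ[ℝ] EuclideanSpace ℝ (Fin p))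
    (u : Metric.sphere (0 : EuclideanSpace ℝ (Fin p)) 1) :
    Metric.sphere (0 : EuclideanSpace ℝ (Fin p)) 1 :=
  ⟨L u, by simp⟩

theorem measurable_sphereMap (L : EuclideanSpace ℝ (Fin p) ≃ₗᵢ[ℝ] EuclideanSpace ℝ (Fin p)) :
    Measurable (sphereMap L) :=
  (L.continuous.measurable.comp measurable_subtype_coe).subtype_mk

/-- Up to a constant, the surface measure of `s` is the volume of the cone `(0, 1) • s`. A linear
isometry commutes with forming cones and preserves volume. -/
theorem map_sphereMap_uniformSphere
    (L : EuclideanSpace ℝ (Fin p) ≃ₗᵢ[ℝ] EuclideanSpace ℝ (Fin p)) :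
    (uniformSphere p).map (sphereMap L) = uniformSphere p := by
  ext s hs
  rw [Measure.map_apply (measurable_sphereMap L) hs, uniformSphere, Measure.smul_apply,
    Measure.smul_apply, Measure.toSphere_apply' _ hs,
    Measure.toSphere_apply' _ (measurable_sphereMap L hs)]
  have key : Set.Ioo (0 : ℝ) 1 • ((↑) '' (sphereMap L ⁻¹' s) : Set (EuclideanSpace ℝ (Fin p))) =
      L ⁻¹' (Set.Ioo (0 : ℝ) 1 • ((↑) '' s)) := by
    ext x
    simp only [Set.mem_smul, Set.mem_preimage, Set.mem_image]
    constructor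
    · rintro ⟨r, hr, _, ⟨u, hu, rfl⟩, rfl⟩
      exact ⟨r, hr, L u, ⟨sphereMap L u, hu, rfl⟩, by simp⟩
    · rintro ⟨r, hr, _, ⟨u, hu, rfl⟩, hx⟩
      refine ⟨r, hr, L.symm u, ⟨sphereMap L.symm u, ?_, rfl⟩, ?_⟩
      · convert hu
        ext1
        simp [sphereMap]
      · apply L.injective
        simp [hx]
  rw [key, L.measurePreserving.measure_preimage_emb L.toHomeomorph.measurableEmbedding]

theorem integral_uniformSphere_comp_isometry
    (L : EuclideanSpace ℝ (Fin p) ≃ₗᵢ[ℝ] EuclideanSpace ℝ (Fin p))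
    {f : EuclideanSpace ℝ (Fin p) → ℝ} (hf : Continuous f) :
    ∫ u, f (L u) ∂uniformSphere p = ∫ u, f u ∂uniformSphere p := by
  conv_rhs => rw [← map_sphereMap_uniformSphere L]
  exact (integral_map (measurable_sphereMap L).aemeasurable
    (hf.comp continuous_subtype_val).aestronglyMeasurable).symm

/-- The reflection which changes the sign of the `a`-th coordinate. -/
def flipCoord (a : Fin p) : EuclideanSpace ℝ (Fin p) ≃ₗᵢ[ℝ] EuclideanSpace ℝ (Fin p) :=
  LinearIsometryEquiv.piLpCongrRight 2
    (fun i => if i = a then LinearIsometryEquiv.neg ℝ else LinearIsometryEquiv.refl ℝ ℝ)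

theorem flipCoord_apply_self (a : Fin p) (x : EuclideanSpace ℝ (Fin p)) :
    flipCoord a x a = -x a := by
  simp [flipCoord]

theorem flipCoord_apply_of_ne {a b : Fin p} (h : b ≠ a) (x : EuclideanSpace ℝ (Fin p)) :
    flipCoord a x b = x b := by
  simp [flipCoord, h]

theorem integral_uniformSphere_coord (a : Fin p) :
    ∫ u, (u : EuclideanSpace ℝ (Fin p)) a ∂uniformSphere p = 0 := by
  have h := integral_uniformSphere_comp_isometry (flipCoord a)
    (f := fun x => x a) (by fun_prop)
  simp only [flipCoord_apply_self, integral_neg] at h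
  linarith

theorem integral_uniformSphere_coord_mul_coord {a b : Fin p} (hab : a ≠ b) :
    ∫ u, (u : EuclideanSpace ℝ (Fin p)) a * (u : EuclideanSpace ℝ (Fin p)) b
      ∂uniformSphere p = 0 := by
  have h := integral_uniformSphere_comp_isometry (flipCoord a)
    (f := fun x => x a * x b) (by fun_prop)
  simp only [flipCoord_apply_self, flipCoord_apply_of_ne hab.symm, neg_mul, integral_neg] at h
  linarith

/-- Swapping coordinates shows that the `p` integrals coincide, and they add up to `1` because `‖u‖
= 1`. -/
theorem integral_uniformSphere_coord_sq (hp : 1 ≤ p) (a : Fin p) :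
    ∫ u, (u : EuclideanSpace ℝ (Fin p)) a * (u : EuclideanSpace ℝ (Fin p)) a
      ∂uniformSphere p = 1 / p := by
  have := isProbabilityMeasure_uniformSphere hp
  have hswap (b : Fin p) :
      ∫ u, (u : EuclideanSpace ℝ (Fin p)) b * (u : EuclideanSpace ℝ (Fin p)) b
        ∂uniformSphere p =
      ∫ u, (u : EuclideanSpace ℝ (Fin p)) a * (u : EuclideanSpace ℝ (Fin p)) a
        ∂uniformSphere p := by
    have h := integral_uniformSphere_comp_isometry
      (LinearIsometryEquiv.piLpCongrLeft 2 ℝ ℝ (Equiv.swap a b))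
      (f := fun x => x a * x a) (by fun_prop)
    simpa [LinearIsometryEquiv.piLpCongrLeft_apply, Equiv.piCongrLeft'] using h
  have hint (b : Fin p) : Integrable (fun u : Metric.sphere (0 : EuclideanSpace ℝ (Fin p)) 1 =>
      (u : EuclideanSpace ℝ (Fin p)) b * (u : EuclideanSpace ℝ (Fin p)) b) (uniformSphere p) := by
    refine Integrable.of_bound (by fun_prop) 1 (ae_of_all _ fun u => ?_)
    have h1 : ‖(u : EuclideanSpace ℝ (Fin p)) b‖ ≤ 1 :=
      (PiLp.norm_apply_le _ b).trans (by simp)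
    rw [norm_mul]
    exact mul_le_one₀ h1 (norm_nonneg _) h1
  have hsum : ∑ b, ∫ u, (u : EuclideanSpace ℝ (Fin p)) b * (u : EuclideanSpace ℝ (Fin p)) b
      ∂uniformSphere p = 1 := by
    rw [← integral_finsetSum _ fun b _ => hint b]
    have (u : Metric.sphere (0 : EuclideanSpace ℝ (Fin p)) 1) :
        ∑ b, (u : EuclideanSpace ℝ (Fin p)) b * (u : EuclideanSpace ℝ (Fin p)) b = 1 := by
      have h := EuclideanSpace.real_norm_sq_eq (u : EuclideanSpace ℝ (Fin p))
      simp only [norm_eq_of_mem_sphere, one_pow] at h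
      exact (Finset.sum_congr rfl fun b _ => by ring).trans h.symm
    simp [this]
  simp only [hswap, Finset.sum_const, Finset.card_univ, Fintype.card_fin, nsmul_eq_mul] at hsum
  have : (p : ℝ) ≠ 0 := by positivity
  rw [eq_div_iff this]
  linarith

end Sphere

/-! ### Moments and integrability under the centered law -/

section Law

variable {p : ℕ}

/-- The law of `c R U` with `R ∼ F` and `U` uniform on the unit sphere, independent of `R`. -/
def isotropicLaw (p : ℕ) (F : Measure ℝ) (c : ℝ) : Measure (EuclideanSpace ℝ (Fin p)) :=
  (F.prod (uniformSphere p)).map (fun z => (c * z.1) • (z.2 : EuclideanSpace ℝ (Fin p)))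

theorem sqrt_smul_one {lam : ℝ} (hlam : 0 < lam) :
    CFC.sqrt (lam • (1 : Matrix (Fin p) (Fin p) ℝ)) = √lam • 1 := by
  refine CFC.sqrt_unique ?_ ?_
  · rw [smul_mul_smul_comm, Real.mul_self_sqrt hlam.le, one_mul]
  · rw [Matrix.nonneg_iff_posSemidef]
    exact Matrix.PosSemidef.one.smul (Real.sqrt_nonneg _)

theorem hasLaw_sub_isotropicLaw {F : Measure ℝ} {m : EuclideanSpace ℝ (Fin p)} {lam : ℝ}
    (hlam : 0 < lam) {Ω : Type*} [MeasurableSpace Ω] {P : Measure Ω}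
    {X : Ω → EuclideanSpace ℝ (Fin p)}
    (hX : HasLaw X (ellipticalLaw F m (lam • (1 : Matrix (Fin p) (Fin p) ℝ))) P) :
    HasLaw (fun ω => X ω - m) (isotropicLaw p F √lam) P where
  aemeasurable := hX.aemeasurable.sub_const m
  map_eq := by
    have hg : Measurable fun x : EuclideanSpace ℝ (Fin p) => x - m := by fun_prop
    have hcomp := AEMeasurable.map_map_of_aemeasurable (μ := P) hg.aemeasurable hX.aemeasurable
    change P.map ((fun x => x - m) ∘ X) = _
    rw [← hcomp, hX.map_eq, ellipticalLaw, sqrt_smul_one hlam, Measure.map_map hg (by fun_prop),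
      isotropicLaw]
    congr 1
    ext z : 1
    simp [Matrix.toEuclideanLin, smul_smul, mul_comm]

variable {F : Measure ℝ} [IsProbabilityMeasure F] {c : ℝ}

theorem isProbabilityMeasure_isotropicLaw (hp : 1 ≤ p) :
    IsProbabilityMeasure (isotropicLaw p F c) := by
  have := isProbabilityMeasure_uniformSphere hp
  exact Measure.isProbabilityMeasure_map (by fun_prop)

/-- Radius and direction are independent, so an integrand that separates in polar form integrates to
a product. All moments below reduce to this. -/
theorem integral_isotropicLaw_of_eq_mul (hp : 1 ≤ p) {h : EuclideanSpace ℝ (Fin p) → ℝ}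
    (hh : Continuous h) (f : ℝ → ℝ) (g : EuclideanSpace ℝ (Fin p) → ℝ)
    (hfg : ∀ r u, ‖u‖ = 1 → h ((c * r) • u) = f r * g u) :
    ∫ y, h y ∂isotropicLaw p F c = (∫ r, f r ∂F) * ∫ u, g u ∂uniformSphere p := by
  have := isProbabilityMeasure_uniformSphere hp
  rw [isotropicLaw, integral_map (by fun_prop) hh.aestronglyMeasurable,
    ← integral_prod_mul f fun u : Metric.sphere (0 : EuclideanSpace ℝ (Fin p)) 1 => g u]
  exact integral_congr_ae (ae_of_all _ fun z => hfg _ _ (by simp))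

theorem integral_norm_pow_isotropicLaw (hp : 1 ≤ p) (k : ℕ) :
    ∫ y, ‖y‖ ^ (2 * k) ∂isotropicLaw p F c = (c ^ 2) ^ k * radialMoment F (2 * k) := by
  have := isProbabilityMeasure_uniformSphere hp
  rw [integral_isotropicLaw_of_eq_mul hp (by fun_prop) (fun r => (c ^ 2) ^ k * r ^ (2 * k))
    (fun _ => 1), integral_const_mul, radialMoment]
  · simp
  · intro r u hu
    rw [norm_smul, hu, mul_one, mul_one, Real.norm_eq_abs, pow_mul, sq_abs, mul_pow, mul_pow,
      pow_mul]

theorem integral_coord_isotropicLaw (hp : 1 ≤ p) (a : Fin p) :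
    ∫ y, y a ∂isotropicLaw p F c = 0 := by
  rw [integral_isotropicLaw_of_eq_mul hp (by fun_prop) (fun r => c * r) (fun u => u a),
    integral_uniformSphere_coord, mul_zero]
  simp

theorem integral_norm_sq_mul_coord_isotropicLaw (hp : 1 ≤ p) (a : Fin p) :
    ∫ y, ‖y‖ ^ 2 * y a ∂isotropicLaw p F c = 0 := by
  rw [integral_isotropicLaw_of_eq_mul hp (by fun_prop) (fun r => (c * r) ^ 3) (fun u => u a),
    integral_uniformSphere_coord, mul_zero]
  intro r u hu
  rw [norm_smul, hu, mul_one, Real.norm_eq_abs, sq_abs, PiLp.smul_apply, smul_eq_mul]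
  ring

theorem integral_coord_mul_coord_isotropicLaw (hp : 1 ≤ p) (a b : Fin p) :
    ∫ y, y a * y b ∂isotropicLaw p F c =
      if a = b then c ^ 2 * radialMoment F 2 / p else 0 := by
  rw [integral_isotropicLaw_of_eq_mul hp (by fun_prop) (fun r => c ^ 2 * r ^ 2)
    (fun u => u a * u b), integral_const_mul, ← radialMoment]
  · split_ifs with hab
    · rw [hab, integral_uniformSphere_coord_sq hp]
      ring
    · rw [integral_uniformSphere_coord_mul_coord hab, mul_zero]
  · intro r u hu
    simp only [PiLp.smul_apply, smul_eq_mul]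
    ring

theorem integrable_of_growth (hp : 1 ≤ p) (hF : Integrable (fun r : ℝ => r ^ 8) F)
    {h : EuclideanSpace ℝ (Fin p) → ℝ} (hh : Continuous h) {C : ℝ}
    (hC : ∀ y, |h y| ≤ C * (1 + ‖y‖ ^ 8)) : Integrable h (isotropicLaw p F c) := by
  have := isProbabilityMeasure_uniformSphere hp
  rw [isotropicLaw, integrable_map_measure hh.aestronglyMeasurable (by fun_prop)]
  have hdom : Integrable (fun z : ℝ × Metric.sphere (0 : EuclideanSpace ℝ (Fin p)) 1 =>
      C * (1 + c ^ 8 * z.1 ^ 8)) (F.prod (uniformSphere p)) :=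
    (((integrable_const _).add (hF.const_mul _)).const_mul _).comp_fst _
  refine hdom.mono' ((hh.comp (by fun_prop)).aestronglyMeasurable) (ae_of_all _ fun z => ?_)
  refine (hC _).trans_eq ?_
  rw [norm_smul, norm_eq_of_mem_sphere, mul_one, Real.norm_eq_abs, Even.pow_abs (by decide),
    mul_pow]

/-- Squaring doubles the growth exponent, which is where the eighth moment of `R` is needed. -/
theorem memLp_two_of_growth (hp : 1 ≤ p) (hF : Integrable (fun r : ℝ => r ^ 8) F)
    {h : EuclideanSpace ℝ (Fin p) → ℝ} (hh : Continuous h) {C : ℝ}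
    (hC : ∀ y, |h y| ≤ C * (1 + ‖y‖ ^ 4)) : MemLp h 2 (isotropicLaw p F c) := by
  rw [memLp_two_iff_integrable_sq hh.aestronglyMeasurable]
  refine integrable_of_growth hp hF (hh.pow 2) (C := 2 * C ^ 2) fun y => ?_
  rw [abs_pow]
  calc |h y| ^ 2 ≤ (C * (1 + ‖y‖ ^ 4)) ^ 2 := pow_le_pow_left₀ (abs_nonneg _) (hC y) 2
    -- The difference of the two sides is `C² (1 - ‖y‖⁴)²`.
    _ ≤ 2 * C ^ 2 * (1 + ‖y‖ ^ 8) := by nlinarith [mul_nonneg (sq_nonneg C) (sq_nonneg (1 - ‖y‖ ^ 4))]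

theorem pow_le_one_add_pow {x : ℝ} (hx : 0 ≤ x) {k l : ℕ} (hkl : k ≤ l) : x ^ k ≤ 1 + x ^ l := by
  rcases le_total x 1 with h | h
  · linarith [pow_le_one₀ (n := k) hx h, pow_nonneg hx l]
  · linarith [pow_le_pow_right₀ h hkl]

theorem integrable_norm_pow_isotropicLaw (hp : 1 ≤ p) (hF : Integrable (fun r : ℝ => r ^ 8) F)
    {k : ℕ} (hk : k ≤ 8) :
    Integrable (fun y : EuclideanSpace ℝ (Fin p) => ‖y‖ ^ k) (isotropicLaw p F c) :=
  integrable_of_growth hp hF (by fun_prop) (C := 1) fun y => by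
    rw [abs_of_nonneg (by positivity), one_mul]
    exact pow_le_one_add_pow (norm_nonneg _) hk

theorem integral_norm_poly_isotropicLaw (hp : 1 ≤ p) (hF : Integrable (fun r : ℝ => r ^ 8) F)
    (a₀ a₁ a₂ a₃ a₄ : ℝ) :
    ∫ y, (a₀ + a₁ * ‖y‖ ^ 2 + a₂ * ‖y‖ ^ 4 + a₃ * ‖y‖ ^ 6 + a₄ * ‖y‖ ^ 8) ∂isotropicLaw p F c =
      a₀ + a₁ * (c ^ 2 * radialMoment F 2) + a₂ * ((c ^ 2) ^ 2 * radialMoment F 4) +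
        a₃ * ((c ^ 2) ^ 3 * radialMoment F 6) + a₄ * ((c ^ 2) ^ 4 * radialMoment F 8) := by
  have := isProbabilityMeasure_isotropicLaw (F := F) (c := c) hp
  have hi {k : ℕ} (hk : k ≤ 8) (a : ℝ) :
      Integrable (fun y : EuclideanSpace ℝ (Fin p) => a * ‖y‖ ^ k) (isotropicLaw p F c) :=
    (integrable_norm_pow_isotropicLaw hp hF hk).const_mul a
  have h2 := hi (k := 2) (by norm_num) a₁
  have h4 := hi (k := 4) (by norm_num) a₂
  have h6 := hi (k := 6) (by norm_num) a₃
  have h8 := hi (k := 8) (by norm_num) a₄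
  have h0 := integrable_const (μ := isotropicLaw p F c) a₀
  rw [integral_add ?_ h8, integral_add ?_ h6, integral_add ?_ h4, integral_add h0 h2]
  rotate_left
  · exact h0.add h2
  · exact (h0.add h2).add h4
  · exact ((h0.add h2).add h4).add h6
  simp only [integral_const_mul, integral_const, probReal_univ, one_smul]
  have e1 := integral_norm_pow_isotropicLaw (F := F) (c := c) hp 1
  have e2 := integral_norm_pow_isotropicLaw (F := F) (c := c) hp 2
  have e3 := integral_norm_pow_isotropicLaw (F := F) (c := c) hp 3
  have e4 := integral_norm_pow_isotropicLaw (F := F) (c := c) hp 4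
  norm_num only [pow_one] at e1 e2 e3 e4
  rw [e1, e2, e3, e4]

end Law

/-! ### Positivity of radial moments -/

section Moments

theorem radialMoment_two_pos {F : Measure ℝ} [IsProbabilityMeasure F]
    (hF : Integrable (fun r : ℝ => r ^ 8) F)
    (hF0 : ¬ ∀ᵐ r ∂F, r = 0) : 0 < radialMoment F 2 := by
  have hi : Integrable (fun r : ℝ => r ^ 2) F := by
    refine ((integrable_const 1).add hF).mono' (by fun_prop) (ae_of_all _ fun r => ?_)
    have := pow_le_one_add_pow (abs_nonneg r) (k := 2) (l := 8) (by norm_num)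
    rwa [Even.pow_abs (by decide : Even 8), ← abs_pow] at this
  refine (integral_nonneg fun r => sq_nonneg r).lt_of_ne' fun h => hF0 ?_
  have := (integral_eq_zero_iff_of_nonneg (fun r => sq_nonneg r) hi).1 h
  filter_upwards [this] with r hr
  simpa using hr

theorem radialMoment_four_nonneg {F : Measure ℝ} : 0 ≤ radialMoment F 4 :=
  integral_nonneg fun r => by positivity

end Moments

/-! ### Sample averages: law of large numbers, second moments, negligible remainders -/

section Averages

/-- The average of `h` over the first `n` points of a sequence. -/
def seqAvg {E : Type*} (y : ℕ → E) (n : ℕ) (h : E → ℝ) : ℝ :=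
  (∑ i ∈ Finset.range n, h (y i)) / n

variable {E Ω : Type*} [MeasurableSpace E] [MeasurableSpace Ω] {P : Measure Ω}
  {ν : Measure E} {Y : ℕ → Ω → E}

theorem identDistrib_comp (hlaw : ∀ i, HasLaw (Y i) ν P) {h : E → ℝ} (hh : Measurable h) (i : ℕ) :
    IdentDistrib (fun ω => h (Y i ω)) (fun ω => h (Y 0 ω)) P P :=
  IdentDistrib.comp ⟨(hlaw i).aemeasurable, (hlaw 0).aemeasurable,
    (hlaw i).map_eq.trans (hlaw 0).map_eq.symm⟩ hh

theorem memLp_comp (hlaw : ∀ i, HasLaw (Y i) ν P) {h : E → ℝ} {q : ENNReal} (hq : MemLp h q ν)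
    (i : ℕ) : MemLp (fun ω => h (Y i ω)) q P :=
  MemLp.comp_of_map ((hlaw i).map_eq ▸ hq) (hlaw i).aemeasurable

theorem tendsto_seqAvg (hindep : iIndepFun Y P) (hlaw : ∀ i, HasLaw (Y i) ν P)
    {h : E → ℝ} (hh : Measurable h) (hint : Integrable h ν) :
    ∀ᵐ ω ∂P, Tendsto (fun n => seqAvg (fun i => Y i ω) n h) atTop (nhds (∫ y, h y ∂ν)) := by
  have := strong_law_ae_real (μ := P) (fun i ω => h (Y i ω))
    (memLp_one_iff_integrable.1 (memLp_comp hlaw (memLp_one_iff_integrable.2 hint) 0))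
    (fun i j hij => (hindep.indepFun hij).comp hh hh) (identDistrib_comp hlaw hh)
  rw [← (hlaw 0).integral_comp hint.aestronglyMeasurable]
  exact this

theorem integrable_seqAvg_sq (hlaw : ∀ i, HasLaw (Y i) ν P) {h : E → ℝ} (hL : MemLp h 2 ν)
    (n : ℕ) : Integrable (fun ω => seqAvg (fun i => Y i ω) n h ^ 2) P := by
  simp only [seqAvg, div_eq_mul_inv, mul_pow]
  exact (memLp_finsetSum (Finset.range n) fun i _ => memLp_comp hlaw hL i).integrable_sq.mul_const _

variable [IsProbabilityMeasure P]

theorem integral_seqAvg_sq (hindep : iIndepFun Y P) (hlaw : ∀ i, HasLaw (Y i) ν P)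
    {h : E → ℝ} (hh : Measurable h) (hL : MemLp h 2 ν) (h0 : ∫ y, h y ∂ν = 0) (n : ℕ) :
    ∫ ω, seqAvg (fun i => Y i ω) n h ^ 2 ∂P = Var[h; ν] / n := by
  have hL' := memLp_comp hlaw hL
  have hmean (i : ℕ) : ∫ ω, h (Y i ω) ∂P = 0 := by
    rw [← h0, ← (hlaw i).integral_comp hL.aestronglyMeasurable]
    rfl
  have hvar := IndepFun.variance_sum (s := Finset.range n) (fun i _ => hL' i)
    (fun i _ j _ hij => (hindep.indepFun hij).comp hh hh)
  have hsum : (∑ i ∈ Finset.range n, fun ω => h (Y i ω)) =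
      fun ω => ∑ i ∈ Finset.range n, h (Y i ω) := by
    ext ω
    simp
  have hmeansum : ∫ ω, ∑ i ∈ Finset.range n, h (Y i ω) ∂P = 0 := by
    rw [integral_finsetSum _ fun i _ => (hL' i).integrable (by norm_num)]
    exact Finset.sum_eq_zero fun i _ => hmean i
  have hident (i : ℕ) : Var[fun ω => h (Y i ω); P] = Var[h; ν] := by
    rw [← (hlaw i).map_eq, variance_map (by rw [(hlaw i).map_eq]; exact hh.aemeasurable)
      (hlaw i).aemeasurable]
    rfl
  rw [hsum, variance_of_integral_eq_zero
    (Finset.aemeasurable_fun_sum _ fun i _ => (hL' i).aemeasurable) hmeansum] at hvar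
  simp only [hident, Finset.sum_const, Finset.card_range, nsmul_eq_mul] at hvar
  simp only [seqAvg, div_pow, integral_div]
  rw [hvar]
  -- For `n = 0` both sides are `0`, since division by zero gives `0`.
  rcases eq_or_ne (n : ℝ) 0 with hn | hn
  · simp [hn]
  · field_simp

/-- The `L¹` norm is exactly `(∑ k, Var[h k; ν]) / √n`, and convergence in `L¹` implies convergence
in measure. -/
theorem tendstoInMeasure_sqrt_mul_sum_seqAvg_sq {κ : Type*} [Fintype κ] (hindep : iIndepFun Y P)
    (hlaw : ∀ i, HasLaw (Y i) ν P) {h : κ → E → ℝ} (hh : ∀ k, Measurable (h k))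
    (hL : ∀ k, MemLp (h k) 2 ν) (h0 : ∀ k, ∫ y, h k y ∂ν = 0) :
    TendstoInMeasure P
      (fun (n : ℕ) ω => √n * ∑ k, seqAvg (fun i => Y i ω) n (h k) ^ 2) atTop (fun _ => 0) := by
  have hint (n : ℕ) : Integrable (fun ω => √n * ∑ k, seqAvg (fun i => Y i ω) n (h k) ^ 2) P :=
    (integrable_finsetSum _ fun k _ => integrable_seqAvg_sq hlaw (hL k) n).const_mul _
  refine tendstoInMeasure_of_tendsto_eLpNorm one_ne_zero
    (fun n => (hint n).aestronglyMeasurable) aestronglyMeasurable_const ?_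
  have heq (n : ℕ) : eLpNorm ((fun ω => √n * ∑ k, seqAvg (fun i => Y i ω) n (h k) ^ 2) -
      fun _ => 0) 1 P = ENNReal.ofReal ((∑ k, Var[h k; ν]) * (√n)⁻¹) := by
    rw [show (fun _ : Ω => (0 : ℝ)) = 0 from rfl, sub_zero, eLpNorm_one_eq_lintegral_enorm,
      ← ofReal_integral_norm_eq_lintegral_enorm (hint n)]
    congr 1
    have hnn (ω : Ω) : 0 ≤ √(n : ℝ) * ∑ k, seqAvg (fun i => Y i ω) n (h k) ^ 2 := by positivity
    simp only [Real.norm_of_nonneg (hnn _)]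
    rw [integral_const_mul, integral_finsetSum _ fun k _ => integrable_seqAvg_sq hlaw (hL k) n]
    simp only [integral_seqAvg_sq hindep hlaw (hh _) (hL _) (h0 _)]
    rw [← Finset.sum_div, mul_div_left_comm, Real.sqrt_div_self', one_div]
  simp only [heq]
  rw [← ENNReal.ofReal_zero]
  refine ENNReal.tendsto_ofReal ?_
  rw [← mul_zero (∑ k, Var[h k; ν])]
  exact (tendsto_inv_atTop_zero.comp
    (Real.tendsto_sqrt_atTop.comp tendsto_natCast_atTop_atTop)).const_mul _

/-- If `f` tends to zero in measure, `K` converges almost everywhere and `|g| ≤ K f` eventually,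
then `g` tends to zero in measure. -/
theorem tendstoInMeasure_zero_of_abs_le_mul {f g K : ℕ → Ω → ℝ} {K₀ : ℝ}
    (hg : ∀ n, AEMeasurable (g n) P)
    (hf : TendstoInMeasure P f atTop (fun _ => 0))
    (hK : ∀ᵐ ω ∂P, Tendsto (fun n => K n ω) atTop (nhds K₀))
    (hle : ∀ᶠ n in atTop, ∀ ω, |g n ω| ≤ K n ω * f n ω) :
    TendstoInMeasure P g atTop (fun _ => 0) := by
  -- Along a subsequence `f` converges almost everywhere, so the bound `K f` can be treated
  -- pointwise and no uniform bound on `K` is needed.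
  rw [exists_seq_tendstoInMeasure_atTop_iff fun n => (hg n).aestronglyMeasurable]
  intro ns hns
  obtain ⟨ms, hms, hae⟩ := (hf.comp hns.tendsto_atTop).exists_seq_tendsto_ae
  refine ⟨ms, hms, ?_⟩
  filter_upwards [hae, hK] with ω hω hKω
  have hsub : Tendsto (fun i => ns (ms i)) atTop atTop :=
    hns.tendsto_atTop.comp hms.tendsto_atTop
  have hlim := (hKω.comp hsub).mul hω
  rw [mul_zero] at hlim
  refine squeeze_zero_norm' ?_ hlim
  filter_upwards [hsub.eventually hle] with i hi using hi ω

end Averages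

/-! ### Algebraic expansion of the object shape in sample averages -/

section Algebra

section Linear

variable {E : Type*} (y : ℕ → E) (n : ℕ)

theorem seqAvg_add (f g : E → ℝ) :
    seqAvg y n (fun z => f z + g z) = seqAvg y n f + seqAvg y n g := by
  simp [seqAvg, Finset.sum_add_distrib, add_div]

theorem seqAvg_sub (f g : E → ℝ) :
    seqAvg y n (fun z => f z - g z) = seqAvg y n f - seqAvg y n g := by
  simp [seqAvg, Finset.sum_sub_distrib, sub_div]

theorem seqAvg_const_mul (a : ℝ) (f : E → ℝ) :
    seqAvg y n (fun z => a * f z) = a * seqAvg y n f := by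
  simp [seqAvg, ← Finset.mul_sum, mul_div_assoc]

theorem seqAvg_mul_const (a : ℝ) (f : E → ℝ) :
    seqAvg y n (fun z => f z * a) = seqAvg y n f * a := by
  simp only [mul_comm _ a, seqAvg_const_mul]

theorem seqAvg_sum {ι : Type*} (s : Finset ι) (f : ι → E → ℝ) :
    seqAvg y n (fun z => ∑ a ∈ s, f a z) = ∑ a ∈ s, seqAvg y n (f a) := by
  simp only [seqAvg]
  rw [Finset.sum_comm, Finset.sum_div]

theorem seqAvg_const {n : ℕ} (hn : n ≠ 0) (a : ℝ) : seqAvg y n (fun _ => a) = a := by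
  have : (n : ℝ) ≠ 0 := by exact_mod_cast hn
  simp [seqAvg, this]

theorem seqAvg_nonneg {f : E → ℝ} (hf : ∀ z, 0 ≤ f z) : 0 ≤ seqAvg y n f :=
  div_nonneg (Finset.sum_nonneg fun _ _ => hf _) (Nat.cast_nonneg _)

theorem seqAvg_mono {f g : E → ℝ} (hfg : ∀ z, f z ≤ g z) : seqAvg y n f ≤ seqAvg y n g :=
  div_le_div_of_nonneg_right (Finset.sum_le_sum fun _ _ => hfg _) (Nat.cast_nonneg _)

end Linear

variable {p : ℕ} (y : ℕ → EuclideanSpace ℝ (Fin p)) (n : ℕ)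

/-- The entry `(a, b)` of the matrix `z zᵀ` minus its isotropic part `(‖z‖² / p) I`. -/
def shapeCoord (a b : Fin p) (z : EuclideanSpace ℝ (Fin p)) : ℝ :=
  z a * z b - if a = b then ‖z‖ ^ 2 / p else 0

/-- The numerator of the sample object shape in terms of sample averages. -/
def shapeNum : ℝ :=
  seqAvg y n (fun z => ‖z‖ ^ 4) + 3 * seqAvg y n (fun z => ‖z‖ ^ 2) ^ 2
    + 4 * seqAvg y n (fun z => (∑ a, z a * seqAvg y n fun w => w a) ^ 2)
    - 4 * ∑ a, seqAvg y n (fun z => ‖z‖ ^ 2 * z a) * seqAvg y n (fun z => z a)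
    - 4 * seqAvg y n (fun z => ‖z‖ ^ 2) * ∑ a, seqAvg y n (fun z => z a) ^ 2

/-- The denominator of the sample object shape in terms of sample averages. -/
def shapeDen : ℝ :=
  2 * seqAvg y n (fun z => ‖z‖ ^ 4) + (2 + 4 / p) * seqAvg y n (fun z => ‖z‖ ^ 2) ^ 2
    + 4 * ∑ a, ∑ b, seqAvg y n (shapeCoord a b) ^ 2
    - 8 * ∑ a, seqAvg y n (fun z => ‖z‖ ^ 2 * z a) * seqAvg y n (fun z => z a)

theorem dist_add_sq (v w m : EuclideanSpace ℝ (Fin p)) :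
    dist (v + m) (w + m) ^ 2 = ‖v‖ ^ 2 + ‖w‖ ^ 2 - 2 * ∑ a, v a * w a := by
  rw [dist_add_right, dist_eq_norm, norm_sub_sq_real, PiLp.inner_apply]
  simp [mul_comm]
  ring

theorem seqAvg_dist_sq {n : ℕ} (hn : n ≠ 0) (v m : EuclideanSpace ℝ (Fin p)) :
    seqAvg y n (fun w => dist (v + m) (w + m) ^ 2) =
      ‖v‖ ^ 2 + seqAvg y n (fun z => ‖z‖ ^ 2) - 2 * ∑ a, v a * seqAvg y n fun w => w a := by
  simp only [dist_add_sq, seqAvg_sub, seqAvg_add, seqAvg_const _ hn, seqAvg_const_mul, seqAvg_sum]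

theorem seqAvg_seqAvg_dist_sq_sq {n : ℕ} (hn : n ≠ 0) (m : EuclideanSpace ℝ (Fin p)) :
    seqAvg y n (fun v => seqAvg y n (fun w => dist (v + m) (w + m) ^ 2) ^ 2) = shapeNum y n := by
  simp only [seqAvg_dist_sq y hn, shapeNum]
  have hexp (S : ℝ) (M : Fin p → ℝ) (z : EuclideanSpace ℝ (Fin p)) :
      (‖z‖ ^ 2 + S - 2 * ∑ a, z a * M a) ^ 2 =
      ‖z‖ ^ 4 + S ^ 2 + 4 * (∑ a, z a * M a) ^ 2 + 2 * S * ‖z‖ ^ 2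
        - 4 * ∑ a, ‖z‖ ^ 2 * z a * M a - 4 * S * ∑ a, z a * M a := by
    simp only [mul_assoc, ← Finset.mul_sum]
    ring
  simp only [hexp, seqAvg_sub, seqAvg_add, seqAvg_const _ hn, seqAvg_const_mul, seqAvg_sum,
    seqAvg_mul_const, ← pow_two]
  ring

/-- Pythagoras for the Frobenius norm: the averaged matrix `z zᵀ` splits orthogonally into a
traceless part and a multiple of the identity, whose squared norm is trace squared over `p`. This is
the source of the `4 / p` in `shapeDen`. -/
theorem sum_sum_shapeCoord_sq (hp : 1 ≤ p) :
    ∑ a, ∑ b, seqAvg y n (fun z => z a * z b) ^ 2 =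
      ∑ a, ∑ b, seqAvg y n (shapeCoord a b) ^ 2 + seqAvg y n (fun z => ‖z‖ ^ 2) ^ 2 / p := by
  have hp0 : (p : ℝ) ≠ 0 := by positivity
  set S := seqAvg y n (fun z => ‖z‖ ^ 2) with hS
  have htrace : ∑ a, seqAvg y n (fun z => z a * z a) = S := by
    rw [← seqAvg_sum, hS]
    congr 1
    ext z
    rw [EuclideanSpace.real_norm_sq_eq]
    exact Finset.sum_congr rfl fun a _ => by ring
  have hcoord (a b : Fin p) : seqAvg y n (shapeCoord a b) =
      seqAvg y n (fun z => z a * z b) - if a = b then S / p else 0 := by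
    change seqAvg y n (fun z => z a * z b - if a = b then ‖z‖ ^ 2 / p else 0) = _
    rw [seqAvg_sub]
    congr 1
    split_ifs
    · simp only [div_eq_mul_inv, seqAvg_mul_const, hS]
    · simp [seqAvg]
  have hexp (a b : Fin p) : seqAvg y n (shapeCoord a b) ^ 2 =
      seqAvg y n (fun z => z a * z b) ^ 2 +
        if a = b then -2 * (S / p) * seqAvg y n (fun z => z a * z b) + (S / p) ^ 2 else 0 := by
    rw [hcoord]
    split_ifs <;> ring
  simp only [hexp, Finset.sum_add_distrib, Finset.sum_ite_eq, Finset.mem_univ, if_true,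
    ← Finset.mul_sum, htrace, Finset.sum_const, Finset.card_univ, Fintype.card_fin, nsmul_eq_mul]
  field_simp
  ring

theorem seqAvg_seqAvg_dist_pow_four (hp : 1 ≤ p) {n : ℕ} (hn : n ≠ 0)
    (m : EuclideanSpace ℝ (Fin p)) :
    seqAvg y n (fun v => seqAvg y n (fun w => dist (v + m) (w + m) ^ 4)) = shapeDen y n := by
  have hexp (v w : EuclideanSpace ℝ (Fin p)) : dist (v + m) (w + m) ^ 4 =
      ‖v‖ ^ 4 + ‖w‖ ^ 4 + 2 * ‖v‖ ^ 2 * ‖w‖ ^ 2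
        + 4 * ∑ a, ∑ b, v a * v b * (w a * w b)
        - 4 * ∑ a, ‖v‖ ^ 2 * v a * w a - 4 * ∑ a, v a * (‖w‖ ^ 2 * w a) := by
    have h1 : ∑ a, ∑ b, v a * v b * (w a * w b) = (∑ a, v a * w a) ^ 2 := by
      rw [sq, Finset.sum_mul_sum]
      exact Finset.sum_congr rfl fun a _ => Finset.sum_congr rfl fun b _ => by ring
    have h2 : ∑ a, ‖v‖ ^ 2 * v a * w a = ‖v‖ ^ 2 * ∑ a, v a * w a := by
      rw [Finset.mul_sum]
      exact Finset.sum_congr rfl fun a _ => by ring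
    have h3 : ∑ a, v a * (‖w‖ ^ 2 * w a) = ‖w‖ ^ 2 * ∑ a, v a * w a := by
      rw [Finset.mul_sum]
      exact Finset.sum_congr rfl fun a _ => by ring
    rw [h1, h2, h3, show 4 = 2 * 2 from rfl, pow_mul, dist_add_sq]
    ring
  simp only [hexp, seqAvg_sub, seqAvg_add, seqAvg_const _ hn, seqAvg_const_mul, seqAvg_sum,
    seqAvg_mul_const, shapeDen, ← pow_two]
  rw [sum_sum_shapeCoord_sq y n hp]
  simp only [mul_comm (seqAvg y n fun z => z _)]
  ring

theorem sampleObjectShape_eq (hp : 1 ≤ p) {n : ℕ} (hn : n ≠ 0) (m : EuclideanSpace ℝ (Fin p)) :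
    sampleObjectShape (fun i : Fin n => y i + m) = shapeNum y n / shapeDen y n := by
  have hn' : (n : ℝ) ≠ 0 := by exact_mod_cast hn
  rw [sampleObjectShape, ← seqAvg_seqAvg_dist_sq_sq y hn m,
    ← seqAvg_seqAvg_dist_pow_four y hp hn m]
  congr 1
  -- For fixed `i` the sums over `j` and `k` separate, giving the square of a single sum.
  · simp only [← Finset.mul_sum, ← Finset.sum_mul]
    simp only [seqAvg, div_pow, ← Finset.sum_div, sq (∑ _ ∈ _, _)]
    simp only [Finset.sum_range]
    field_simp
  · simp only [seqAvg, ← Finset.sum_div, Finset.sum_range]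
    field_simp

/-- Statistics whose squared averages control the remainder of the linear expansion. -/
def centeredStat (θ : ℝ) :
    (Fin p ⊕ Fin p) ⊕ (Fin p × Fin p) ⊕ Unit → EuclideanSpace ℝ (Fin p) → ℝ
  | .inl (.inl a), z => z a
  | .inl (.inr a), z => ‖z‖ ^ 2 * z a
  | .inr (.inl ab), z => shapeCoord ab.1 ab.2 z
  | .inr (.inr _), z => ‖z‖ ^ 2 - θ

/-- The leading linear statistic in the expansion of the sample object shape. -/
def linearStat (u θ₁ θ₂ : ℝ) (z : EuclideanSpace ℝ (Fin p)) : ℝ :=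
  (2 * u - 1) * (‖z‖ ^ 4 - θ₂) + 2 * θ₁ * (u * (2 + 4 / p) - 3) * (‖z‖ ^ 2 - θ₁)

theorem sum_centeredStat_sq (θ : ℝ) :
    ∑ k, seqAvg y n (centeredStat θ k) ^ 2 =
      ∑ a, seqAvg y n (fun z => z a) ^ 2 + ∑ a, seqAvg y n (fun z => ‖z‖ ^ 2 * z a) ^ 2 +
      (∑ a, ∑ b, seqAvg y n (shapeCoord a b) ^ 2 + seqAvg y n (fun z => ‖z‖ ^ 2 - θ) ^ 2) := by
  simp only [Fintype.sum_sum_type, Fintype.sum_prod_type, Fintype.sum_unique]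
  rfl

/-- Here `S`, `Q` are the averages of `‖z‖²`, `‖z‖⁴`; `m₂`, `v₂`, `T` are the sums of squared
averages of `z a`, `‖z‖² z a`, `shapeCoord`; `B`, `D` are the mixed terms. By `hu` the constant term
vanishes. As the main part is affine in `Q` and quadratic in `S`, its Taylor remainder is exactly a
multiple of `(S - θ₁)²`, and every other term is already of second order. The constant in the bound
is not sharp. -/
theorem abs_quadratic_remainder_le {u c θ₁ θ₂ S Q T B D m₂ v₂ : ℝ}
    (hu : (2 * u - 1) * θ₂ + (u * c - 3) * θ₁ ^ 2 = 0) (hS : 0 ≤ S) (hT : 0 ≤ T) (hm : 0 ≤ m₂)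
    (hv : 0 ≤ v₂) (hB₀ : 0 ≤ B) (hB : B ≤ S * m₂) (hD : |D| ≤ v₂ + m₂) :
    |u * (2 * Q + c * S ^ 2 + 4 * T - 8 * D) - (Q + 3 * S ^ 2 + 4 * B - 4 * D - 4 * S * m₂)
      - ((2 * u - 1) * (Q - θ₂) + 2 * θ₁ * (u * c - 3) * (S - θ₁))| ≤
      (|u * c - 3| + 12 * |u| + 4 + 8 * S) * (m₂ + v₂ + (T + (S - θ₁) ^ 2)) := by
  have heq : u * (2 * Q + c * S ^ 2 + 4 * T - 8 * D)
      - (Q + 3 * S ^ 2 + 4 * B - 4 * D - 4 * S * m₂)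
      - ((2 * u - 1) * (Q - θ₂) + 2 * θ₁ * (u * c - 3) * (S - θ₁)) =
      (u * c - 3) * (S - θ₁) ^ 2 + u * (4 * T) + u * (-8 * D) + (4 * D + 4 * (S * m₂ - B)) := by
    linear_combination hu
  rw [heq]
  set e := (S - θ₁) ^ 2
  have he : 0 ≤ e := sq_nonneg _
  have h1 : |(u * c - 3) * e| ≤ |u * c - 3| * e := by rw [abs_mul, abs_of_nonneg he]
  have h2 : |u * (4 * T)| ≤ |u| * (4 * T) := by
    rw [abs_mul, abs_of_nonneg (by positivity : 0 ≤ 4 * T)]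
  have h3 : |u * (-8 * D)| ≤ |u| * (8 * (v₂ + m₂)) := by
    rw [abs_mul, abs_mul, abs_of_neg (by norm_num : (-8 : ℝ) < 0), neg_neg]
    gcongr
  have h4 : |4 * D + 4 * (S * m₂ - B)| ≤ 4 * (v₂ + m₂) + 4 * (S * m₂) := by
    rw [abs_le] at hD ⊢
    constructor <;> linarith [hD.1, hD.2]
  have h5 := abs_add_le ((u * c - 3) * e) (u * (4 * T))
  have h6 := abs_add_le ((u * c - 3) * e + u * (4 * T)) (u * (-8 * D))
  have h7 := abs_add_le ((u * c - 3) * e + u * (4 * T) + u * (-8 * D))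
    (4 * D + 4 * (S * m₂ - B))
  have k0 := abs_nonneg (u * c - 3)
  have k1 := abs_nonneg u
  nlinarith [mul_nonneg k0 hm, mul_nonneg k0 hv, mul_nonneg k0 hT, mul_nonneg k1 hm,
    mul_nonneg k1 hv, mul_nonneg k1 hT, mul_nonneg k1 he, mul_nonneg hS hm, mul_nonneg hS hv,
    mul_nonneg hS hT, mul_nonneg hS he]

theorem abs_expansion_remainder_le {n : ℕ} (hn : n ≠ 0) {u θ₁ θ₂ : ℝ}
    (hu : (2 * u - 1) * θ₂ + (u * (2 + 4 / p) - 3) * θ₁ ^ 2 = 0) :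
    |u * shapeDen y n - shapeNum y n - seqAvg y n (linearStat u θ₁ θ₂)| ≤
      (|u * (2 + 4 / p) - 3| + 12 * |u| + 4 + 8 * seqAvg y n (fun z => ‖z‖ ^ 2)) *
        ∑ k, seqAvg y n (centeredStat θ₁ k) ^ 2 := by
  have hlin : seqAvg y n (linearStat u θ₁ θ₂) =
      (2 * u - 1) * (seqAvg y n (fun z => ‖z‖ ^ 4) - θ₂)
        + 2 * θ₁ * (u * (2 + 4 / p) - 3) * (seqAvg y n (fun z => ‖z‖ ^ 2) - θ₁) := by
    change seqAvg y n (fun z => (2 * u - 1) * (‖z‖ ^ 4 - θ₂)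
      + 2 * θ₁ * (u * (2 + 4 / p) - 3) * (‖z‖ ^ 2 - θ₁)) = _
    simp only [seqAvg_sub, seqAvg_add, seqAvg_const _ hn, seqAvg_const_mul]
  rw [hlin, sum_centeredStat_sq, shapeDen, shapeNum]
  simp only [seqAvg_sub, seqAvg_const _ hn]
  obtain ⟨M, hM⟩ : ∃ M : Fin p → ℝ, ∀ a, seqAvg y n (fun w => w a) = M a := ⟨_, fun _ => rfl⟩
  obtain ⟨V, hV⟩ : ∃ V : Fin p → ℝ, ∀ a, seqAvg y n (fun z => ‖z‖ ^ 2 * z a) = V a :=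
    ⟨_, fun _ => rfl⟩
  simp only [hM, hV]
  refine abs_quadratic_remainder_le hu (seqAvg_nonneg _ _ fun z => by positivity)
    (by positivity) (by positivity) (by positivity) (seqAvg_nonneg _ _ fun z => by positivity) ?_ ?_
  -- Cauchy–Schwarz for each `z`, then averaging.
  · rw [← seqAvg_mul_const]
    refine seqAvg_mono _ _ fun z => ?_
    rw [EuclideanSpace.real_norm_sq_eq]
    exact Finset.sum_mul_sq_le_sq_mul_sq _ _ _
  -- Termwise, `|V a * M a| ≤ V a ^ 2 + M a ^ 2`.
  · rw [← Finset.sum_add_distrib]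
    refine (Finset.abs_sum_le_sum_abs _ _).trans (Finset.sum_le_sum fun a _ => ?_)
    rw [abs_le]
    constructor <;> nlinarith [sq_nonneg (V a + M a), sq_nonneg (V a - M a)]

end Algebra

/-! ### Means, variances and square integrability of the statistics -/

section Statistics

variable {p : ℕ}

theorem continuous_centeredStat (θ : ℝ) (k : (Fin p ⊕ Fin p) ⊕ (Fin p × Fin p) ⊕ Unit) :
    Continuous (centeredStat θ k) := by
  rcases k with (a | a) | ⟨a, b⟩ | _
  · change Continuous fun z : EuclideanSpace ℝ (Fin p) => z a
    fun_prop
  · change Continuous fun z : EuclideanSpace ℝ (Fin p) => ‖z‖ ^ 2 * z a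
    fun_prop
  · change Continuous fun z : EuclideanSpace ℝ (Fin p) =>
      z a * z b - if a = b then ‖z‖ ^ 2 / p else 0
    split_ifs <;> fun_prop
  · change Continuous fun z : EuclideanSpace ℝ (Fin p) => ‖z‖ ^ 2 - θ
    fun_prop

theorem abs_centeredStat_le (hp : 1 ≤ p) (θ : ℝ)
    (k : (Fin p ⊕ Fin p) ⊕ (Fin p × Fin p) ⊕ Unit) (z : EuclideanSpace ℝ (Fin p)) :
    |centeredStat θ k z| ≤ (2 + |θ|) * (1 + ‖z‖ ^ 4) := by
  have h0 := norm_nonneg z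
  have hc (a : Fin p) : |z a| ≤ ‖z‖ := PiLp.norm_apply_le z a
  have h1 := pow_le_one_add_pow h0 (k := 1) (l := 4) (by norm_num)
  have h2 := pow_le_one_add_pow h0 (k := 2) (l := 4) (by norm_num)
  have h3 := pow_le_one_add_pow h0 (k := 3) (l := 4) (by norm_num)
  have hθ := abs_nonneg θ
  have h4 : 0 ≤ ‖z‖ ^ 4 := by positivity
  have hθ4 := mul_nonneg hθ h4
  rcases k with (a | a) | ⟨a, b⟩ | _
  · change |z a| ≤ _
    nlinarith [hc a]
  · change |‖z‖ ^ 2 * z a| ≤ _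
    rw [abs_mul, abs_of_nonneg (by positivity)]
    nlinarith [mul_le_mul_of_nonneg_left (hc a) (sq_nonneg ‖z‖)]
  · change |z a * z b - if a = b then ‖z‖ ^ 2 / p else 0| ≤ _
    have hab : |z a * z b| ≤ ‖z‖ ^ 2 := by
      rw [abs_mul, sq]
      exact mul_le_mul (hc a) (hc b) (abs_nonneg _) h0
    have hite : |if a = b then ‖z‖ ^ 2 / (p : ℝ) else 0| ≤ ‖z‖ ^ 2 := by
      split_ifs
      · rw [abs_of_nonneg (by positivity)]
        exact div_le_self (sq_nonneg _) (by exact_mod_cast hp)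
      · simp
    have := abs_sub (z a * z b) (if a = b then ‖z‖ ^ 2 / (p : ℝ) else 0)
    linarith
  · change |‖z‖ ^ 2 - θ| ≤ _
    have := abs_sub (‖z‖ ^ 2) θ
    rw [abs_of_nonneg (sq_nonneg ‖z‖)] at this
    linarith

variable {F : Measure ℝ} [IsProbabilityMeasure F] {c : ℝ}

theorem memLp_centeredStat (hp : 1 ≤ p) (hF : Integrable (fun r : ℝ => r ^ 8) F) (θ : ℝ)
    (k : (Fin p ⊕ Fin p) ⊕ (Fin p × Fin p) ⊕ Unit) :
    MemLp (centeredStat θ k) 2 (isotropicLaw p F c) :=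
  memLp_two_of_growth hp hF (continuous_centeredStat θ k) (abs_centeredStat_le hp θ k)

theorem integral_centeredStat (hp : 1 ≤ p) (hF : Integrable (fun r : ℝ => r ^ 8) F)
    (k : (Fin p ⊕ Fin p) ⊕ (Fin p × Fin p) ⊕ Unit) :
    ∫ z, centeredStat (c ^ 2 * radialMoment F 2) k z ∂isotropicLaw p F c = 0 := by
  have hprob := isProbabilityMeasure_isotropicLaw (F := F) (c := c) hp
  have hn := integral_norm_pow_isotropicLaw (F := F) (c := c) hp 1
  norm_num only [pow_one] at hn
  have hni := integrable_norm_pow_isotropicLaw (c := c) hp hF (k := 2) (by norm_num)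
  rcases k with (a | a) | ⟨a, b⟩ | _
  · exact integral_coord_isotropicLaw hp a
  · exact integral_norm_sq_mul_coord_isotropicLaw hp a
  · have hint := (memLp_centeredStat (c := c) hp hF 0 (.inr (.inl (a, b)))).integrable
      (by norm_num)
    have hab := integral_coord_mul_coord_isotropicLaw (F := F) (c := c) hp a b
    change ∫ z, (z a * z b - if a = b then ‖z‖ ^ 2 / p else 0) ∂isotropicLaw p F c = 0
    change Integrable (fun z : EuclideanSpace ℝ (Fin p) => z a * z b - if a = b then ‖z‖ ^ 2 / (p : ℝ) else 0)
      _ at hint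
    split_ifs at hint hab ⊢ with h
    -- Integrability of the product is recovered by adding the isotropic part back to the integrable
    -- `shapeCoord`.
    · have hi : Integrable (fun z : EuclideanSpace ℝ (Fin p) => z a * z b) (isotropicLaw p F c) := by
        refine (hint.add (hni.div_const (p : ℝ))).congr (ae_of_all _ fun z => ?_)
        simp
      rw [integral_sub hi (hni.div_const _), hab, integral_div, hn, sub_self]
    · simpa using hab
  · change ∫ z, (‖z‖ ^ 2 - c ^ 2 * radialMoment F 2) ∂isotropicLaw p F c = 0
    rw [integral_sub hni (integrable_const _), hn]
    simp

/-- An affine combination of `‖z‖ ^ 4` and `‖z‖ ^ 2`. -/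
def normQuartic (a b θ₁ θ₂ : ℝ) (z : EuclideanSpace ℝ (Fin p)) : ℝ :=
  a * (‖z‖ ^ 4 - θ₂) + b * (‖z‖ ^ 2 - θ₁)

theorem continuous_normQuartic (a b θ₁ θ₂ : ℝ) :
    Continuous (normQuartic (p := p) a b θ₁ θ₂) := by
  unfold normQuartic
  fun_prop

theorem memLp_normQuartic (hp : 1 ≤ p) (hF : Integrable (fun r : ℝ => r ^ 8) F)
    (a b θ₁ θ₂ : ℝ) : MemLp (normQuartic a b θ₁ θ₂) 2 (isotropicLaw p F c) := by
  refine memLp_two_of_growth hp hF (continuous_normQuartic a b θ₁ θ₂)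
    (C := |a| * (1 + |θ₂|) + |b| * (1 + |θ₁|)) fun z => ?_
  have h2 := pow_le_one_add_pow (norm_nonneg z) (k := 2) (l := 4) (by norm_num)
  have h4 : 0 ≤ ‖z‖ ^ 4 := by positivity
  have e4 : |‖z‖ ^ 4 - θ₂| ≤ (1 + |θ₂|) * (1 + ‖z‖ ^ 4) := by
    have := abs_sub (‖z‖ ^ 4) θ₂
    rw [abs_of_nonneg h4] at this
    nlinarith [mul_nonneg (abs_nonneg θ₂) h4]
  have e2 : |‖z‖ ^ 2 - θ₁| ≤ (1 + |θ₁|) * (1 + ‖z‖ ^ 4) := by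
    have := abs_sub (‖z‖ ^ 2) θ₁
    rw [abs_of_nonneg (sq_nonneg ‖z‖)] at this
    nlinarith [mul_nonneg (abs_nonneg θ₁) h4]
  have h := abs_add_le (a * (‖z‖ ^ 4 - θ₂)) (b * (‖z‖ ^ 2 - θ₁))
  rw [abs_mul, abs_mul] at h
  have := mul_le_mul_of_nonneg_left e4 (abs_nonneg a)
  have := mul_le_mul_of_nonneg_left e2 (abs_nonneg b)
  unfold normQuartic
  linarith

theorem integral_normQuartic (hp : 1 ≤ p) (hF : Integrable (fun r : ℝ => r ^ 8) F) (a b : ℝ) :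
    ∫ z, normQuartic a b (c ^ 2 * radialMoment F 2) ((c ^ 2) ^ 2 * radialMoment F 4) z
      ∂isotropicLaw p F c = 0 := by
  have h := integral_norm_poly_isotropicLaw (c := c) hp hF
    (-a * ((c ^ 2) ^ 2 * radialMoment F 4) - b * (c ^ 2 * radialMoment F 2)) b a 0 0
  trans 0 + 0
  · convert h using 1
    · congr 1
      ext z
      rw [normQuartic]
      ring
    · ring
  · simp

theorem variance_normQuartic (hp : 1 ≤ p) (hF : Integrable (fun r : ℝ => r ^ 8) F) (a b : ℝ) :
    Var[normQuartic a b (c ^ 2 * radialMoment F 2) ((c ^ 2) ^ 2 * radialMoment F 4);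
      isotropicLaw p F c] =
      a ^ 2 * (c ^ 2) ^ 4 * (radialMoment F 8 - radialMoment F 4 ^ 2) +
      2 * a * b * (c ^ 2) ^ 3 * (radialMoment F 6 - radialMoment F 4 * radialMoment F 2) +
      b ^ 2 * (c ^ 2) ^ 2 * (radialMoment F 4 - radialMoment F 2 ^ 2) := by
  rw [variance_of_integral_eq_zero (continuous_normQuartic _ _ _ _).measurable.aemeasurable
    (integral_normQuartic hp hF a b)]
  -- `C` is the constant term of `normQuartic`; the coefficients below are those of `(C + b t² + a
  -- t⁴)²`.
  set C := -a * ((c ^ 2) ^ 2 * radialMoment F 4) - b * (c ^ 2 * radialMoment F 2) with hC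
  have h := integral_norm_poly_isotropicLaw (c := c) hp hF
    (C ^ 2) (2 * b * C) (b ^ 2 + 2 * a * C) (2 * a * b) (a ^ 2)
  convert h using 1
  · congr 1
    ext z
    rw [normQuartic, hC]
    ring
  · rw [hC]
    ring

end Statistics

/-! ### Closed forms of the limiting constants -/

section Constants

variable {p : ℕ} {F : Measure ℝ} {lam : ℝ}

theorem uR_eq (hq : 0 < radialMoment F 2) (hp : 1 ≤ p) :
    uR p F = 1 / 2 + ((p : ℝ) - 1) * radialMoment F 2 ^ 2 /
      ((p : ℝ) * (radialMoment F 4 + radialMoment F 2 ^ 2) + 2 * radialMoment F 2 ^ 2) := by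
  have h4 : 0 ≤ radialMoment F 4 := radialMoment_four_nonneg
  have hp0 : (0 : ℝ) < p := by exact_mod_cast hp
  rw [uR, betaR]
  congr 1
  rw [div_eq_div_iff (by positivity) (by positivity)]
  field_simp

/-- The almost sure limit of the denominator of the sample object shape. -/
def denLimit (p : ℕ) (F : Measure ℝ) (lam : ℝ) : ℝ :=
  2 * (lam ^ 2 * radialMoment F 4) + (2 + 4 / p) * (lam * radialMoment F 2) ^ 2

theorem denLimit_pos (hq : 0 < radialMoment F 2) (hlam : 0 < lam) : 0 < denLimit p F lam := by
  have h4 : 0 ≤ radialMoment F 4 := radialMoment_four_nonneg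
  unfold denLimit
  positivity

/-- This coefficient scales as `lam⁻²` and the next one as `lam⁻¹`, which cancels the powers of
`lam` in `variance_normQuartic`; hence the asymptotic variance does not depend on `lam`. -/
theorem linear_coeff_quartic (hq : 0 < radialMoment F 2) (hp : 1 ≤ p) (hlam : 0 < lam) :
    (2 * uR p F - 1) / denLimit p F lam = (p : ℝ) * (p - 1) * radialMoment F 2 ^ 2 /
      (((p : ℝ) * (radialMoment F 4 + radialMoment F 2 ^ 2) + 2 * radialMoment F 2 ^ 2) ^ 2
        * lam ^ 2) := by
  have h4 : 0 ≤ radialMoment F 4 := radialMoment_four_nonneg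
  have hp0 : (0 : ℝ) < p := by exact_mod_cast hp
  have hd := denLimit_pos (p := p) hq hlam
  rw [uR_eq hq hp, div_eq_div_iff hd.ne' (by positivity), denLimit]
  field_simp
  ring

theorem linear_coeff_quadratic (hq : 0 < radialMoment F 2) (hp : 1 ≤ p) (hlam : 0 < lam) :
    2 * (lam * radialMoment F 2) * (uR p F * (2 + 4 / p) - 3) / denLimit p F lam =
      -(2 * (p : ℝ) * (p - 1) * radialMoment F 2 * radialMoment F 4) /
      (((p : ℝ) * (radialMoment F 4 + radialMoment F 2 ^ 2) + 2 * radialMoment F 2 ^ 2) ^ 2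
        * lam) := by
  have h4 : 0 ≤ radialMoment F 4 := radialMoment_four_nonneg
  have hp0 : (0 : ℝ) < p := by exact_mod_cast hp
  have hd := denLimit_pos (p := p) hq hlam
  rw [uR_eq hq hp, div_eq_div_iff hd.ne' (by positivity), denLimit]
  field_simp
  ring

/-- Rearranged from `u (2 θ₂ + (2 + 4/p) θ₁²) = θ₂ + 3 θ₁²`, that is, `u` times the limit of the
denominator is the limit of the numerator. -/
theorem uR_mul_denLimit (hq : 0 < radialMoment F 2) (hp : 1 ≤ p) :
    (2 * uR p F - 1) * (lam ^ 2 * radialMoment F 4) +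
      (uR p F * (2 + 4 / p) - 3) * (lam * radialMoment F 2) ^ 2 = 0 := by
  have h4 : 0 ≤ radialMoment F 4 := radialMoment_four_nonneg
  have hp0 : (0 : ℝ) < p := by exact_mod_cast hp
  rw [uR_eq hq hp]
  field_simp
  ring

end Constants

/-! ### Limit theorems for the denominator and for the linearized statistic -/

section Limit

theorem sigmaSqR_eq_variance {p : ℕ} (hp : 1 ≤ p) {F : Measure ℝ} [IsProbabilityMeasure F]
    (hF : Integrable (fun r : ℝ => r ^ 8) F) (hq : 0 < radialMoment F 2) {lam : ℝ}
    (hlam : 0 < lam) :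
    Var[normQuartic ((2 * uR p F - 1) / denLimit p F lam)
        (2 * (lam * radialMoment F 2) * (uR p F * (2 + 4 / p) - 3) / denLimit p F lam)
        (lam * radialMoment F 2) (lam ^ 2 * radialMoment F 4);
      isotropicLaw p F √lam] = sigmaSqR p F := by
  have h4 : 0 ≤ radialMoment F 4 := radialMoment_four_nonneg
  have hp0 : (0 : ℝ) < p := by exact_mod_cast hp
  have h := variance_normQuartic (c := √lam) hp hF ((2 * uR p F - 1) / denLimit p F lam)
    (2 * (lam * radialMoment F 2) * (uR p F * (2 + 4 / p) - 3) / denLimit p F lam)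
  rw [Real.sq_sqrt hlam.le] at h
  rw [h, linear_coeff_quartic hq hp hlam, linear_coeff_quadratic hq hp hlam, sigmaSqR]
  field_simp
  ring

variable {p : ℕ} {Ω : Type*} [MeasurableSpace Ω] {P : Measure Ω}

theorem aemeasurable_shapeNum {Y : ℕ → Ω → EuclideanSpace ℝ (Fin p)}
    (hY : ∀ i, AEMeasurable (Y i) P) (n : ℕ) :
    AEMeasurable (fun ω => shapeNum (fun i => Y i ω) n) P := by
  unfold shapeNum seqAvg
  fun_prop

theorem aemeasurable_shapeDen {Y : ℕ → Ω → EuclideanSpace ℝ (Fin p)}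
    (hY : ∀ i, AEMeasurable (Y i) P) (n : ℕ) :
    AEMeasurable (fun ω => shapeDen (fun i => Y i ω) n) P := by
  have (a b : Fin p) (i : ℕ) : AEMeasurable (fun ω => shapeCoord a b (Y i ω)) P := by
    unfold shapeCoord
    split_ifs <;> fun_prop
  unfold shapeDen seqAvg
  fun_prop

theorem aemeasurable_sampleObjectShape {X : ℕ → Ω → EuclideanSpace ℝ (Fin p)}
    (hX : ∀ i, AEMeasurable (X i) P) (n : ℕ) :
    AEMeasurable (fun ω => sampleObjectShape (fun i : Fin n => X i ω)) P := by
  unfold sampleObjectShape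
  fun_prop

variable {F : Measure ℝ} [IsProbabilityMeasure F] {lam : ℝ}
  {Y : ℕ → Ω → EuclideanSpace ℝ (Fin p)}

theorem tendsto_shapeDen (hp : 1 ≤ p) (hF : Integrable (fun r : ℝ => r ^ 8) F) (hlam : 0 < lam)
    (hindep : iIndepFun Y P) (hlaw : ∀ i, HasLaw (Y i) (isotropicLaw p F √lam) P) :
    ∀ᵐ ω ∂P, Tendsto (fun n => shapeDen (fun i => Y i ω) n) atTop (nhds (denLimit p F lam)) := by
  have hprob := isProbabilityMeasure_isotropicLaw (F := F) (c := √lam) hp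
  have hstat : ∀ᵐ ω ∂P, ∀ k, Tendsto (fun n => seqAvg (fun i => Y i ω) n
      (centeredStat ((√lam) ^ 2 * radialMoment F 2) k)) atTop (nhds 0) := by
    rw [ae_all_iff]
    intro k
    rw [← integral_centeredStat (c := √lam) hp hF k]
    exact tendsto_seqAvg hindep hlaw (continuous_centeredStat _ k).measurable
      ((memLp_centeredStat hp hF _ k).integrable (by norm_num))
  have hnorm (k : ℕ) (hk : 2 * k ≤ 8) : ∀ᵐ ω ∂P, Tendsto (fun n => seqAvg (fun i => Y i ω) n
      (fun z => ‖z‖ ^ (2 * k))) atTop (nhds (lam ^ k * radialMoment F (2 * k))) := by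
    have h := integral_norm_pow_isotropicLaw (F := F) (c := √lam) hp k
    rw [Real.sq_sqrt hlam.le] at h
    rw [← h]
    exact tendsto_seqAvg hindep hlaw (by fun_prop) (integrable_norm_pow_isotropicLaw hp hF hk)
  filter_upwards [hstat, hnorm 1 (by norm_num), hnorm 2 (by norm_num)] with ω hk h1 h2
  norm_num only [pow_one] at h1 h2
  have hM (a : Fin p) := hk (.inl (.inl a))
  have hV (a : Fin p) := hk (.inl (.inr a))
  have hT (a b : Fin p) := hk (.inr (.inl (a, b)))
  have hTsum := tendsto_finsetSum Finset.univ fun a _ => tendsto_finsetSum Finset.univ fun b _ =>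
    (hT a b).pow 2
  have hVM := tendsto_finsetSum Finset.univ fun a _ => (hV a).mul (hM a)
  have h := (((h2.const_mul 2).add ((h1.pow 2).const_mul (2 + 4 / (p : ℝ)))).add
    (hTsum.const_mul 4)).sub (hVM.const_mul 8)
  -- The sums of zeros are the limits of the second-order terms of `shapeDen`.
  have hlim : denLimit p F lam = 2 * (lam ^ 2 * radialMoment F 4)
      + (2 + 4 / (p : ℝ)) * (lam * radialMoment F 2) ^ 2
      + 4 * ∑ _a : Fin p, ∑ _b : Fin p, (0 : ℝ) ^ 2 - 8 * ∑ _a : Fin p, (0 : ℝ) * 0 := by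
    simp [denLimit]
  rw [hlim]
  exact h

theorem tendstoInDistribution_sqrt_mul_expansion [IsProbabilityMeasure P] (hp : 1 ≤ p)
    (hF : Integrable (fun r : ℝ => r ^ 8) F) (hq : 0 < radialMoment F 2) (hlam : 0 < lam)
    (hindep : iIndepFun Y P) (hlaw : ∀ i, HasLaw (Y i) (isotropicLaw p F √lam) P) :
    TendstoInDistribution (fun (n : ℕ) ω => √n *
        ((uR p F * shapeDen (fun i => Y i ω) n - shapeNum (fun i => Y i ω) n) / denLimit p F lam))
      atTop (id : ℝ → ℝ) (fun _ => P) (gaussianReal 0 (sigmaSqR p F).toNNReal) := by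
  have hprob := isProbabilityMeasure_isotropicLaw (F := F) (c := √lam) hp
  have hY (i : ℕ) := (hlaw i).aemeasurable
  have hd := denLimit_pos (p := p) hq hlam
  set d := denLimit p F lam
  set u := uR p F
  set θ₁ := lam * radialMoment F 2 with hθ₁
  set θ₂ := lam ^ 2 * radialMoment F 4
  set W : EuclideanSpace ℝ (Fin p) → ℝ :=
    normQuartic ((2 * u - 1) / d) (2 * θ₁ * (u * (2 + 4 / p) - 3) / d) θ₁ θ₂ with hW
  have hWc : Continuous W := continuous_normQuartic _ _ _ _
  have hWL : MemLp W 2 (isotropicLaw p F √lam) := memLp_normQuartic hp hF _ _ _ _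
  have hWmean : ∫ ω, W (Y 0 ω) ∂P = 0 := by
    have h := integral_normQuartic (c := √lam) hp hF ((2 * u - 1) / d)
      (2 * θ₁ * (u * (2 + 4 / p) - 3) / d)
    rw [Real.sq_sqrt hlam.le] at h
    exact ((hlaw 0).integral_comp hWL.aestronglyMeasurable).trans h
  have hWvar : Var[fun ω => W (Y 0 ω); P] = sigmaSqR p F := by
    rw [← sigmaSqR_eq_variance hp hF hq hlam, ← (hlaw 0).map_eq,
      variance_map (continuous_normQuartic _ _ _ _).measurable.aemeasurable (hY 0)]
    rfl
  have hclt := tendstoInDistribution_inv_sqrt_mul_sum_sub (P := P)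
    (P' := gaussianReal 0 (sigmaSqR p F).toNNReal) (Y := id) (X := fun i ω => W (Y i ω))
    (by rw [hWvar]; exact HasLaw.id) (memLp_comp hlaw hWL 0)
    (hindep.comp (fun _ => W) fun _ => hWc.measurable) (identDistrib_comp hlaw hWc.measurable)
  rw [hWmean] at hclt
  -- The central limit theorem holds for `W`, which is `linearStat` divided by `d`; it remains to
  -- see that the remainder, multiplied by `√n`, vanishes in measure.
  refine tendstoInDistribution_of_tendstoInMeasure_sub _ _ hclt ?_ fun n =>
    ((((aemeasurable_shapeDen hY n).const_mul _).sub (aemeasurable_shapeNum hY n)).div_const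
      _).const_mul _
  have hQ := tendstoInMeasure_sqrt_mul_sum_seqAvg_sq hindep hlaw
    (fun k => (continuous_centeredStat (√lam ^ 2 * radialMoment F 2) k).measurable)
    (fun k => memLp_centeredStat hp hF _ k) (fun k => integral_centeredStat hp hF k)
  rw [Real.sq_sqrt hlam.le, ← hθ₁] at hQ
  have hS := tendsto_seqAvg hindep hlaw (h := fun z => ‖z‖ ^ 2) (by fun_prop)
    (integrable_norm_pow_isotropicLaw hp hF (by norm_num))
  have hK : ∀ᵐ ω ∂P, Tendsto (fun n => (|u * (2 + 4 / p) - 3| + 12 * |u| + 4 +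
      8 * seqAvg (fun i => Y i ω) n (fun z => ‖z‖ ^ 2)) / d) atTop
      (nhds ((|u * (2 + 4 / p) - 3| + 12 * |u| + 4 +
        8 * ∫ z, ‖z‖ ^ 2 ∂isotropicLaw p F √lam) / d)) := by
    filter_upwards [hS] with ω hω
    exact ((hω.const_mul 8).const_add _).div_const d
  refine tendstoInMeasure_zero_of_abs_le_mul (fun n => ?_) hQ hK ?_
  · exact AEMeasurable.sub (((((aemeasurable_shapeDen hY n).const_mul _).sub
      (aemeasurable_shapeNum hY n)).div_const _).const_mul _) (hclt.forall_aemeasurable n)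
  · filter_upwards [eventually_ne_atTop 0] with n hn ω
    have hrem := abs_expansion_remainder_le (fun i => Y i ω) hn
      (uR_mul_denLimit (F := F) (lam := lam) hq hp)
    have hlin : seqAvg (fun i => Y i ω) n (linearStat u θ₁ θ₂) =
        d * seqAvg (fun i => Y i ω) n W := by
      rw [← seqAvg_const_mul]
      congr 1
      ext z
      rw [hW, linearStat, normQuartic]
      field_simp
    have hn' : (n : ℝ) ≠ 0 := by exact_mod_cast hn
    -- The term `n * 0` is the centering by the mean of `W`, already rewritten as `0`.
    have hsum : (√(n : ℝ))⁻¹ * (∑ k ∈ Finset.range n, W (Y k ω) - n * 0) =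
        √n * seqAvg (fun i => Y i ω) n W := by
      rw [seqAvg, mul_zero, sub_zero, mul_div_left_comm, Real.sqrt_div_self', mul_comm, one_div]
    rw [Pi.sub_apply, Pi.sub_apply, hsum, ← mul_sub, abs_mul, abs_of_nonneg (Real.sqrt_nonneg _),
      mul_left_comm]
    refine mul_le_mul_of_nonneg_left ?_ (Real.sqrt_nonneg _)
    rw [div_mul_eq_mul_div, le_div_iff₀ hd]
    refine le_trans (le_of_eq ?_) hrem
    rw [hlin, ← abs_of_pos hd, ← abs_mul, abs_of_pos hd]
    rw [sub_mul, div_mul_cancel₀ _ hd.ne', mul_comm d]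

end Limit

end ObjectShape

end

/-! ### Slutsky's theorem and the conclusion -/

theorem theorem3 {p : ℕ} (hp : 1 ≤ p)
    (F : Measure ℝ) [IsProbabilityMeasure F]
    (hF_nonneg : ∀ᵐ r ∂F, 0 ≤ r)
    (hF_nondeg : ¬ ∀ᵐ r ∂F, r = 0)
    (hF_moment : Integrable (fun r : ℝ => r ^ 8) F)
    (m : EuclideanSpace ℝ (Fin p)) (lam : ℝ) (hlam : 0 < lam)
    {Ω : Type*} [MeasurableSpace Ω] (P : Measure Ω) [IsProbabilityMeasure P]
    (X : ℕ → Ω → EuclideanSpace ℝ (Fin p))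
    (hX_indep : iIndepFun X P)
    (hX_law : ∀ i, HasLaw (X i)
      (ObjectShape.ellipticalLaw F m (lam • (1 : Matrix (Fin p) (Fin p) ℝ))) P) :
    0 ≤ ObjectShape.sigmaSqR p F ∧
      TendstoInDistribution
        (fun (n : ℕ) (ω : Ω) => Real.sqrt n *
          (ObjectShape.uR p F - ObjectShape.sampleObjectShape (fun i : Fin n => X i ω)))
        atTop (id : ℝ → ℝ) (fun _ => P)
        (gaussianReal 0 (ObjectShape.sigmaSqR p F).toNNReal) := by
  have hq := ObjectShape.radialMoment_two_pos hF_moment hF_nondeg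
  refine ⟨?_, ?_⟩
  · rw [← ObjectShape.sigmaSqR_eq_variance hp hF_moment hq hlam]
    exact variance_nonneg _ _
  have hlaw (i : ℕ) := ObjectShape.hasLaw_sub_isotropicLaw hlam (hX_law i)
  have hindep : iIndepFun (fun i ω => X i ω - m) P :=
    hX_indep.comp (fun _ x => x - m) fun _ => by fun_prop
  have hY (i : ℕ) := (hlaw i).aemeasurable
  have hd := ObjectShape.denLimit_pos (p := p) hq hlam
  have hden := ObjectShape.tendsto_shapeDen hp hF_moment hlam hindep hlaw
  have hexp := ObjectShape.tendstoInDistribution_sqrt_mul_expansion hp hF_moment hq hlam hindep hlaw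
  have hratio : TendstoInMeasure P (fun n ω => ObjectShape.denLimit p F lam /
      ObjectShape.shapeDen (fun i => X i ω - m) n) atTop (fun _ => 1) := by
    refine tendstoInMeasure_of_tendsto_ae
      (fun n => ((ObjectShape.aemeasurable_shapeDen hY n).const_div _).aestronglyMeasurable) ?_
    filter_upwards [hden] with ω hω
    rw [← div_self hd.ne']
    exact tendsto_const_nhds.div hω hd.ne'
  have hprod := hexp.continuous_comp_prodMk_of_tendstoInMeasure_const
    (g := fun x : ℝ × ℝ => x.1 * x.2) (by fun_prop) hratio
    fun n => (ObjectShape.aemeasurable_shapeDen hY n).const_div _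
  simp only [id_eq, mul_one] at hprod
  have hmeas (n : ℕ) : AEMeasurable (fun ω => √(n : ℝ) *
      (ObjectShape.uR p F - ObjectShape.sampleObjectShape (fun i : Fin n => X i ω))) P :=
    ((ObjectShape.aemeasurable_sampleObjectShape (fun i => (hX_law i).aemeasurable)
      n).const_sub _).const_mul _
  -- The two sequences agree as soon as `n ≠ 0` and the denominator is nonzero. Almost surely this
  -- holds eventually, because the denominator has a positive limit, so their difference is
  -- eventually `0`.
  refine tendstoInDistribution_of_tendstoInMeasure_sub _ _ hprod ?_ hmeas
  refine tendstoInMeasure_of_tendsto_ae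
    (fun n => ((hmeas n).sub (hprod.forall_aemeasurable n)).aestronglyMeasurable) ?_
  filter_upwards [hden] with ω hω
  refine tendsto_const_nhds.congr' ?_
  filter_upwards [eventually_ne_atTop 0, hω.eventually_ne hd.ne'] with n hn hD
  have hO := ObjectShape.sampleObjectShape_eq (fun i => X i ω - m) hp hn m
  simp only [sub_add_cancel] at hO
  rw [Pi.sub_apply, Pi.sub_apply, hO, Pi.zero_apply]
  field_simp
  ring
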